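/- Let $p\ge 1$, let $a\in\mathbb C\setminus\{0\}$, and let $f\in\mathrm{Diff}(\mathbb C,0)$, that is, $f$ is a biholomorphic map from an open neighbourhood $U$ of $0$ onto an open set $f(U)$, with $f(0)=0$. Suppose that $f(z)=z+az^{p+1}+O(z^{p+2})$ as $z\to 0$. A direction is a number $v\in\mathbb C$ with $|v|=1$; it is attracting if $av^p/|a|$ is a negative real number and repelling if $av^p/|a|$ is a positive real number. An attracting petal of $f$ centred at $v$ is a simply connected open set $P\subseteq U$ such that $0\in\partial P$, $f(P)\subseteq P$, and, for every $z\in P$, $f^n(z)\to 0$ and $f^n(z)/|f^n(z)|\to v$ as $n\to+\infty$. A repelling petal of $f$ centred at $v$ is an attracting petal of $f^{-1}:f(U)\to U$ centred at $v$. Then there are exactly $p$ attracting directions $v_1^+,\dots,v_p^+$ and exactly $p$ repelling directions $v_1^-,\dots,v_p^-$, and they can be ordered so that, starting at $v_i^+$ and moving counterclockwise, one first meets $v_i^-$ and then $v_{i+1}^+$ (indices modulo $p$). For every such ordering there are sets $P_i^+$, $P_i^-$ ($1\le i\le p$) such that (a) $P_i^+$ is an attracting petal of $f$ centred at $v_i^+$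 and $P_i^-$ is a repelling petal of $f$ centred at $v_i^-$, for each $i$; (b) $\{0\}\cup\bigcup_i P_i^+\cup\bigcup_i P_i^-$ is a neighbourhood of $0$; (c) $P_i^+\cap P_j^+=\emptyset$ and $P_i^-\cap P_j^-=\emptyset$ for $i\ne j$. Moreover: (d) on each attracting petal $P$ of $f$ centred at an attracting direction (in particular on each $P_i^+$), $f$ is holomorphically conjugate to the translation $T(w)=w+1$: there is an injective holomorphic function $\varphi:P\to\mathbb C$ with $\varphi(f(z))=\varphi(z)+1$ for all $z\in P$. -/

import Mathlib

open Topology Asymptotics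

/-- The attracting directions of `z + a z^(p+1) + ⋯`: the unit complex numbers `v` such that
`a v^p / |a|` is a negative real number. -/
def IsAttractingDirection (a : ℂ) (p : ℕ) (v : ℂ) : Prop :=
  ‖v‖ = 1 ∧ ∃ r : ℝ, r < 0 ∧ a * v ^ p / (‖a‖ : ℂ) = (r : ℂ)

/-- The repelling directions of `z + a z^(p+1) + ⋯`: the unit complex numbers `v` such that
`a v^p / |a|` is a positive real number. -/
def IsRepellingDirection (a : ℂ) (p : ℕ) (v : ℂ) : Prop :=
  ‖v‖ = 1 ∧ ∃ r : ℝ, 0 < r ∧ a * v ^ p / (‖a‖ : ℂ) = (r : ℂ)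

/-- `vp 0, …, vp (p-1)` is a list without repetition of all attracting directions and
`vm 0, …, vm (p-1)` one of all repelling directions of `z + a z^(p+1) + ⋯`, ordered by the rule:
starting at `vp i` and moving counterclockwise, the first direction met is `vm i` and the next one
is `vp (i + 1)` (the addition of `Fin p` is cyclic). -/
structure IsOrderedDirections (a : ℂ) (p : ℕ) [NeZero p] (vp vm : Fin p → ℂ) : Prop where
  injective_att : Function.Injective vp
  injective_rep : Function.Injective vm
  range_att : Set.range vp = {v | IsAttractingDirection a p v}
  range_rep : Set.range vm = {v | IsRepellingDirection a p v}
  order : ∀ i : Fin p, ∃ s t : ℝ, 0 < s ∧ s < t ∧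
    vm i = vp i * Complex.exp (s * Complex.I) ∧
    vp (i + 1) = vp i * Complex.exp (t * Complex.I) ∧
    ∀ θ : ℝ, 0 < θ → θ < t → θ ≠ s →
      ¬ IsAttractingDirection a p (vp i * Complex.exp (θ * Complex.I)) ∧
      ¬ IsRepellingDirection a p (vp i * Complex.exp (θ * Complex.I))

/-- `f` represents an element of `Diff (ℂ, 0)`: it is a biholomorphic map from an open
neighbourhood `f.source` of `0` onto an open set `f.target`, and it fixes `0`. (The inverse
`f.symm` of a holomorphic `f` is automatically holomorphic.) -/
structure RepresentsDiff (f : OpenPartialHomeomorph ℂ ℂ) : Prop where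
  zero_mem : (0 : ℂ) ∈ f.source
  map_zero : f 0 = 0
  holomorphic : DifferentiableOn ℂ f f.source

/-- `f z = z + a z^(p+1) + ⋯` near `0`, the dots standing for terms of order at least `p + 2`. -/
def HasExpansion (f : ℂ → ℂ) (a : ℂ) (p : ℕ) : Prop :=
  (fun z : ℂ => f z - (z + a * z ^ (p + 1))) =O[𝓝 0] fun z : ℂ => z ^ (p + 2)

/-- `P` is an attracting petal of `f` centred at `v`. -/
structure IsAttractingPetal (f : OpenPartialHomeomorph ℂ ℂ) (v : ℂ) (P : Set ℂ) : Prop where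
  isOpen : IsOpen P
  simplyConnected : IsSimplyConnected P
  subset_source : P ⊆ f.source
  zero_mem_frontier : (0 : ℂ) ∈ frontier P
  mapsTo : Set.MapsTo f P P
  tendsto_zero : ∀ z ∈ P, Filter.Tendsto (fun n : ℕ => f^[n] z) Filter.atTop (𝓝 0)
  tendsto_direction : ∀ z ∈ P,
    Filter.Tendsto (fun n : ℕ => f^[n] z / (‖f^[n] z‖ : ℂ)) Filter.atTop (𝓝 v)

/-- A repelling petal of `f` is an attracting petal of the inverse of `f`. -/
def IsRepellingPetal (f : OpenPartialHomeomorph ℂ ℂ) (v : ℂ) (P : Set ℂ) : Prop :=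
  IsAttractingPetal f.symm v P

/-- `f` is holomorphically conjugate on the open set `P` to the translation `w ↦ w + 1`: there is a
univalent holomorphic function `φ` on `P` (hence a biholomorphic map from `P` onto `φ '' P`)
with `φ (f z) = φ z + 1`. -/
def IsConjugateToTranslationOn (f : ℂ → ℂ) (P : Set ℂ) : Prop :=
  ∃ φ : ℂ → ℂ, DifferentiableOn ℂ φ P ∧ Set.InjOn φ P ∧ ∀ z ∈ P, φ (f z) = φ z + 1

/-! Write `f z = z exp(L z)` with `L z = a z^p + ⋯`. In the coordinate `w = -1/(p a z^p)` the map
multiplies `w` by `exp(-p L z)`, so it becomes `F w = w + 1 + O(|w|^(-1/p))`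
(`HasExpansion.exists_log`, `HasExpansion.exists_isNearTranslation`). The coordinate has one inverse
branch on the slit plane for each attracting direction `v`, sending the positive axis to the ray
through `v`.

The petal at `v` is the branch image of `re w + |im w| > R`. This region is invariant under `F`; its
orbits go to infinity with argument tending to `0`, so in the variable `z` they tend to `0` in the
direction `v`. The inverse germ has `-a` in place of `a` (`HasExpansion.symm`), so repelling petals
are the same construction in the coordinate `-w`. Since the region contains every large `w` with `re
w ≥ 0`, the two families cover a punctured neighbourhood of `0`; images of different branches are
disjoint.

For the conjugacy, `F^n w - F^n w₀` converges on a right half-plane to an injective solution of `φ ∘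
F = φ + 1` (`exists_fatou_coordinate`), because Cauchy's estimate makes the derivative of the error
`O(n^(-1-s))` along orbits, which is summable. Every orbit of an attracting petal at `v` enters the
branch image of this half-plane, so `φ` extends to the petal along iterates. -/

/-! ### Perturbed translations and the Fatou coordinate on a half-plane. -/

/-- If `‖F w - w - 1‖ ≤ 1/2` on an invariant set, then the orbits of `F` move to the right with
speed at least `1/2`. -/
theorem re_iterate_ge {F : ℂ → ℂ} {S : Set ℂ} (hS : Set.MapsTo F S S)
    (hF : ∀ w ∈ S, ‖F w - w - 1‖ ≤ 1 / 2) {w : ℂ} (hw : w ∈ S) (n : ℕ) :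
    w.re + n / 2 ≤ (F^[n] w).re := by
  induction n with
  | zero => simp
  | succ n ih =>
    rw [Function.iterate_succ_apply']
    have h := (Complex.abs_re_le_norm _).trans (hF _ (hS.iterate n hw))
    simp only [Complex.sub_re, Complex.one_re] at h
    push_cast
    linarith [(abs_le.1 h).1]

/-- Cauchy's estimate for a perturbation of a translation. -/
theorem norm_sub_le_of_re_le {E : ℂ → ℂ} {R C s ρ : ℝ} (hs : 0 < s) (hC : 0 ≤ C) (hR : 0 < R)
    (hE : DifferentiableOn ℂ E {w | R < w.re}) (hb : ∀ w, R < w.re → ‖E w‖ ≤ C * w.re ^ (-s))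
    (hρ : 2 * R < ρ) {w w' : ℂ} (hw : ρ ≤ w.re) (hw' : ρ ≤ w'.re) :
    ‖E w - E w'‖ ≤ C * (ρ / 2) ^ (-1 - s) * ‖w - w'‖ := by
  have hopen : IsOpen {w : ℂ | R < w.re} := isOpen_lt continuous_const Complex.continuous_re
  have hconv : Convex ℝ {w : ℂ | ρ ≤ w.re} := convex_halfSpace_re_ge ρ
  refine hconv.norm_image_sub_le_of_norm_deriv_le (f := E) (fun x hx => ?_) (fun x hx => ?_) hw' hw
  · have hx : ρ ≤ x.re := hx
    exact hE.differentiableAt (hopen.mem_nhds (show R < x.re by linarith))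
  · have hx : ρ ≤ x.re := hx
    -- The disc of radius `ρ / 2` stays in `re ≥ ρ / 2 > R`, so Cauchy's bound for the derivative is
    -- `C (ρ/2)^(-s) / (ρ/2)`.
    have hball : ∀ z ∈ Metric.closedBall x (ρ / 2), ρ / 2 ≤ z.re := by
      intro z hz
      have h := (Complex.abs_re_le_norm _).trans (mem_closedBall_iff_norm.1 hz)
      simp only [Complex.sub_re] at h
      linarith [(abs_le.1 h).1]
    have hd : DiffContOnCl ℂ E (Metric.ball x (ρ / 2)) := by
      refine (hE.mono fun z hz => ?_).diffContOnCl_ball (U := Metric.closedBall x (ρ/2)) subset_rfl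
      exact lt_of_lt_of_le (by linarith) (hball z hz)
    have h2 : 0 < ρ / 2 := by linarith
    refine (Complex.norm_deriv_le_of_forall_mem_sphere_norm_le h2 hd (C := C * (ρ / 2) ^ (-s))
      fun z hz => ?_).trans (le_of_eq ?_)
    · have hz := hball z (Metric.sphere_subset_closedBall hz)
      refine (hb z (by linarith)).trans (mul_le_mul_of_nonneg_left ?_ hC)
      exact Real.rpow_le_rpow_of_nonpos h2 hz (by linarith)
    · rw [show (-1 - s : ℝ) = -s - 1 by ring, Real.rpow_sub_one h2.ne']
      ring

/-- A holomorphic map with `F w = w + 1 + O(|w|⁻ˢ)`, `s > 0`, is conjugate to the translation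
`w ↦ w + 1` on a right half-plane. -/
theorem exists_fatou_coordinate {F : ℂ → ℂ} {R C s : ℝ} (hs : 0 < s) (hC : 0 ≤ C) (hR : 0 < R)
    (hF : DifferentiableOn ℂ F {w | R < w.re})
    (hb : ∀ w, R < w.re → ‖F w - w - 1‖ ≤ C * w.re ^ (-s)) :
    ∃ R', R ≤ R' ∧ (∀ w : ℂ, R' < w.re → R' < (F w).re) ∧
      ∃ φ : ℂ → ℂ, DifferentiableOn ℂ φ {w | R' < w.re} ∧ Set.InjOn φ {w | R' < w.re} ∧
        ∀ w : ℂ, R' < w.re → φ (F w) = φ w + 1 := by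
  -- The `1 / 4` arises since `norm_sub_le_of_re_le` is applied with `ρ = (n + N) / 2`, hence `ρ / 2
  -- = (n + N) / 4`.
  set K : ℝ := C * (1 / 4) ^ (-1 - s) with hK
  have hsum : Summable fun n : ℕ => K * (n : ℝ) ^ (-1 - s) :=
    (Real.summable_nat_rpow.2 (by linarith)).mul_left K
  have hC0 : Filter.Tendsto (fun x : ℝ => C * (x / 2) ^ (-s)) Filter.atTop (𝓝 0) := by
    have := ((tendsto_rpow_neg_atTop hs).comp
      (Filter.tendsto_id.atTop_div_const (two_pos : (0 : ℝ) < 2))).const_mul C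
    simpa using this
  -- The three conditions give, in turn, control of the distortion of all iterates, error at most
  -- `1/2` on `re w > N / 2`, and `ρ > 2 R` in Cauchy's estimate.
  obtain ⟨N, hN1, hN2, hN3⟩ : ∃ N : ℕ, ∑' n : ℕ, K * ((n + N : ℕ) : ℝ) ^ (-1 - s) ≤ 1 / 4 ∧
      C * ((N : ℝ) / 2) ^ (-s) ≤ 1 / 2 ∧ 4 * R < N := by
    refine ((((tendsto_sum_nat_add fun n : ℕ => K * (n : ℝ) ^ (-1 - s)).eventually
      (Iic_mem_nhds (by norm_num : (0 : ℝ) < 1 / 4))).and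
      (((hC0.comp tendsto_natCast_atTop_atTop).eventually
      (Iic_mem_nhds (by norm_num : (0 : ℝ) < 1 / 2))).and
      (tendsto_natCast_atTop_atTop.eventually (Filter.eventually_gt_atTop (4 * R))))).exists)
  set R' : ℝ := N / 2 with hR'
  set H : Set ℂ := {w | R' < w.re} with hH
  set E : ℂ → ℂ := fun w => F w - w - 1 with hE
  set b : ℕ → ℝ := fun n => K * ((n + N : ℕ) : ℝ) ^ (-1 - s) with hbdef
  have hbs : Summable b := (summable_nat_add_iff N).2 hsum
  have hb0 : ∀ n, 0 ≤ b n := fun n => by positivity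
  have hHo : IsOpen H := isOpen_lt continuous_const Complex.continuous_re
  have hhalf : ∀ w, R' < w.re → ‖F w - w - 1‖ ≤ 1 / 2 := fun w hw =>
    (hb w (by linarith)).trans ((mul_le_mul_of_nonneg_left
      (Real.rpow_le_rpow_of_nonpos (by linarith) hw.le (by linarith)) hC).trans hN2)
  have hmaps : Set.MapsTo F H H := by
    intro w hw
    have h := (Complex.abs_re_le_norm _).trans (hhalf w hw)
    simp only [Complex.sub_re, Complex.one_re] at h
    have hw : R' < w.re := hw
    exact show R' < (F w).re by linarith [(abs_le.1 h).1]
  have hre : ∀ {w}, w ∈ H → ∀ n : ℕ, ((n + N : ℕ) : ℝ) / 2 ≤ (F^[n] w).re := by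
    intro w hw n
    have := re_iterate_ge hmaps hhalf hw n
    have hw : R' < w.re := hw
    push_cast
    linarith
  have hEd : DifferentiableOn ℂ E {w | R < w.re} :=
    (hF.sub differentiableOn_id).sub (differentiableOn_const 1)
  have hstep : ∀ {w w'}, w ∈ H → w' ∈ H → ∀ n : ℕ,
      ‖E (F^[n] w) - E (F^[n] w')‖ ≤ b n * ‖F^[n] w - F^[n] w'‖ := by
    intro w w' hw hw' n
    have hn : (N : ℝ) ≤ ((n + N : ℕ) : ℝ) := by push_cast; linarith [n.cast_nonneg (α := ℝ)]
    refine (norm_sub_le_of_re_le hs hC hR hEd hb (ρ := ((n + N : ℕ) : ℝ) / 2) (by linarith)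
      (hre hw n) (hre hw' n)).trans (le_of_eq ?_)
    rw [hbdef, hK]
    dsimp only
    rw [show ((n + N : ℕ) : ℝ) / 2 / 2 = 1 / 4 * ((n + N : ℕ) : ℝ) by ring,
      Real.mul_rpow (by norm_num) (by positivity)]
    ring
  have hdiff : ∀ w w' (n : ℕ), F^[n + 1] w - F^[n + 1] w' =
      F^[n] w - F^[n] w' + (E (F^[n] w) - E (F^[n] w')) := by
    intro w w' n
    simp only [Function.iterate_succ_apply', hE]
    ring
  have hpart : ∀ n, ∑ k ∈ Finset.range n, b k ≤ 1 / 4 := fun n =>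
    (hbs.sum_le_tsum _ fun k _ => hb0 k).trans hN1
  -- The factor `2` closes the induction: partial sums at most `1/4` give distortion at most `1/2`,
  -- so the distance of the iterates stays below `2 ‖w - w'‖`.
  have hclose : ∀ {w w'}, w ∈ H → w' ∈ H → ∀ n : ℕ,
      ‖F^[n] w - F^[n] w' - (w - w')‖ ≤ 2 * (∑ k ∈ Finset.range n, b k) * ‖w - w'‖ := by
    intro w w' hw hw' n
    induction n with
    | zero => simp
    | succ n ih =>
      have h1 : ‖F^[n] w - F^[n] w'‖ ≤ 2 * ‖w - w'‖ := by
        have := norm_add_le (F^[n] w - F^[n] w' - (w - w')) (w - w')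
        rw [sub_add_cancel] at this
        have h2 := mul_le_mul_of_nonneg_right (hpart n) (norm_nonneg (w - w'))
        linarith [norm_nonneg (w - w')]
      have h3 := (hstep hw hw' n).trans (mul_le_mul_of_nonneg_left h1 (hb0 n))
      rw [hdiff, add_sub_right_comm, Finset.sum_range_succ]
      refine (norm_add_le _ _).trans ?_
      linarith
  have hterm : ∀ {w w'}, w ∈ H → w' ∈ H → ∀ n : ℕ,
      ‖E (F^[n] w) - E (F^[n] w')‖ ≤ b n * (2 * ‖w - w'‖) := by
    intro w w' hw hw' n
    refine (hstep hw hw' n).trans (mul_le_mul_of_nonneg_left ?_ (hb0 n))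
    have := norm_add_le (F^[n] w - F^[n] w' - (w - w')) (w - w')
    rw [sub_add_cancel] at this
    have h2 := mul_le_mul_of_nonneg_right (hpart n) (norm_nonneg (w - w'))
    linarith [hclose hw hw' n, norm_nonneg (w - w')]
  have hw₀ : ((R' + 1 : ℝ) : ℂ) ∈ H := show R' < (((R' + 1 : ℝ) : ℂ)).re by simp
  set w₀ : ℂ := ((R' + 1 : ℝ) : ℂ)
  -- The telescoped form of `lim (F^n w - F^n w₀)`, to which the Weierstrass test applies.
  set φ : ℂ → ℂ := fun w => w - w₀ + ∑' n, (E (F^[n] w) - E (F^[n] w₀)) with hφ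
  have hlim : ∀ {w}, w ∈ H →
      Filter.Tendsto (fun n => F^[n] w - F^[n] w₀) Filter.atTop (𝓝 (φ w)) := by
    intro w hw
    have hs' : Summable fun n => E (F^[n] w) - E (F^[n] w₀) :=
      Summable.of_norm_bounded (hbs.mul_right _) (hterm hw hw₀)
    refine (hs'.hasSum.tendsto_sum_nat.const_add (w - w₀)).congr fun n => ?_
    induction n with
    | zero => simp
    | succ n ih => rw [Finset.sum_range_succ, ← add_assoc, ih, hdiff]
  have hiter : ∀ n, Set.MapsTo F^[n] H H := fun n => hmaps.iterate n
  refine ⟨R', by linarith, fun w hw => hmaps hw, φ, ?_, ?_, ?_⟩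
  · intro w hw
    -- The bound on the terms grows with the distance to `w₀`, so it is uniform only on bounded
    -- pieces of `H`.
    have hU : IsOpen (H ∩ Metric.ball w₀ (‖w - w₀‖ + 1)) := hHo.inter Metric.isOpen_ball
    have hFH : DifferentiableOn ℂ F H := hF.mono fun z hz => show R < z.re by
      have hz : R' < z.re := hz
      linarith
    have hFn : ∀ n, DifferentiableOn ℂ F^[n] H := by
      intro n
      induction n with
      | zero => exact differentiableOn_id
      | succ n ih => exact ih.comp hFH hmaps
    have hd : DifferentiableOn ℂ (fun w => ∑' n, (E (F^[n] w) - E (F^[n] w₀)))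
        (H ∩ Metric.ball w₀ (‖w - w₀‖ + 1)) := by
      refine Complex.differentiableOn_tsum_of_summable_norm
        (hbs.mul_right (2 * (‖w - w₀‖ + 1))) (fun n => ?_) hU fun n z hz => ?_
      · refine DifferentiableOn.mono ?_ Set.inter_subset_left
        exact ((hEd.mono fun z hz => show R < z.re by
          have hz : R' < z.re := hz
          linarith).comp (hFn n) (hiter n)).sub_const _
      · refine (hterm hz.1 hw₀ n).trans (mul_le_mul_of_nonneg_left ?_ (hb0 n))
        have := (mem_ball_iff_norm.1 hz.2).le
        linarith
    have hmem : w ∈ H ∩ Metric.ball w₀ (‖w - w₀‖ + 1) :=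
      ⟨hw, mem_ball_iff_norm.2 (by linarith)⟩
    exact ((differentiableAt_id.sub_const w₀).add
      (hd.differentiableAt (hU.mem_nhds hmem))).differentiableWithinAt
  · intro w hw w' hw' heq
    -- In the limit `φ w - φ w'` is within `‖w - w'‖ / 2` of `w - w'`, which forces injectivity.
    have h1 := (((hlim hw).sub (hlim hw')).sub_const (w - w')).norm
    rw [heq] at h1
    have h2 : ‖φ w' - φ w' - (w - w')‖ ≤ 1 / 2 * ‖w - w'‖ := by
      refine le_of_tendsto h1 (Filter.Eventually.of_forall fun n => ?_)
      rw [show F^[n] w - F^[n] w₀ - (F^[n] w' - F^[n] w₀) - (w - w') =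
        F^[n] w - F^[n] w' - (w - w') by ring]
      refine (hclose hw hw' n).trans (mul_le_mul_of_nonneg_right ?_ (norm_nonneg _))
      linarith [hpart n]
    rw [sub_self, zero_sub, norm_neg] at h2
    exact sub_eq_zero.1 (norm_le_zero_iff.1 (by linarith))
  · intro w hw
    have h1 := (hlim hw).comp (Filter.tendsto_add_atTop_nat 1)
    have hE0 : Filter.Tendsto (fun n => E (F^[n] w₀)) Filter.atTop (𝓝 0) := by
      refine squeeze_zero_norm (a := fun n : ℕ => C * ((n + N : ℕ) / 2 : ℝ) ^ (-s))
        (fun n => ?_) ?_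
      · have hn : (N : ℝ) ≤ ((n + N : ℕ) : ℝ) := by push_cast; linarith [n.cast_nonneg (α := ℝ)]
        have := hre hw₀ n
        exact (hb _ (by linarith)).trans (mul_le_mul_of_nonneg_left
          (Real.rpow_le_rpow_of_nonpos (by linarith) this (by linarith)) hC)
      · exact (hC0.comp tendsto_natCast_atTop_atTop).comp (Filter.tendsto_add_atTop_nat N)
    -- As `F^(n+1) w₀ = F^n w₀ + 1 + E (F^n w₀)`, this sequence is `F^n (F w) - F^n w₀`.
    have h2 := (h1.add hE0).add_const 1
    refine tendsto_nhds_unique (hlim (hmaps hw)) ?_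
    rw [add_zero] at h2
    refine h2.congr fun n => ?_
    simp only [Function.comp, Function.iterate_succ_apply', hE, ← Function.iterate_succ_apply]
    ring

/-! ### The model domain: geometry and dynamics. -/

/-- The region to the right of the broken line `re w + |im w| = R`. -/
def petalDomain (R : ℝ) : Set ℂ := {w | R < w.re + |w.im|}

theorem isOpen_petalDomain (R : ℝ) : IsOpen (petalDomain R) :=
  isOpen_lt continuous_const (Complex.continuous_re.add Complex.continuous_im.abs)

/-- On a segment issuing from a real point `|im|` is linear, so `re + |im|` is affine there and the
domain is star-shaped about `R + 1`. -/
theorem isSimplyConnected_petalDomain (R : ℝ) : IsSimplyConnected (petalDomain R) := by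
  have hmem : ((R + 1 : ℝ) : ℂ) ∈ petalDomain R := by simp [petalDomain]
  have hstar : StarConvex ℝ ((R + 1 : ℝ) : ℂ) (petalDomain R) := by
    intro w hw α β hα hβ hαβ
    have hw : R < w.re + |w.im| := hw
    simp only [petalDomain, Set.mem_ofPred_eq, Complex.real_smul, Complex.add_re, Complex.add_im,
      Complex.re_ofReal_mul, Complex.im_ofReal_mul, Complex.ofReal_re, Complex.ofReal_im, mul_zero,
      zero_add, abs_mul, abs_of_nonneg hβ]
    obtain rfl : α = 1 - β := by linarith
    rcases hβ.eq_or_lt with rfl | hβ'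
    · linarith
    · nlinarith
  have := hstar.contractibleSpace ⟨_, hmem⟩
  exact inferInstanceAs (SimplyConnectedSpace (petalDomain R))

theorem lt_norm_of_mem_petalDomain {R : ℝ} {w : ℂ} (hw : w ∈ petalDomain R) : R / 2 < ‖w‖ := by
  have hw : R < w.re + |w.im| := hw
  linarith [Complex.re_le_norm w, Complex.abs_im_le_norm w]

theorem ne_zero_of_mem_petalDomain {R : ℝ} (hR : 0 ≤ R) {w : ℂ} (hw : w ∈ petalDomain R) :
    w ≠ 0 :=
  norm_pos_iff.1 (lt_of_le_of_lt (by positivity) (lt_norm_of_mem_petalDomain hw))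

theorem mem_petalDomain_of_re_nonneg {R : ℝ} {w : ℂ} (hw : 0 ≤ w.re) (hR : R < ‖w‖) :
    w ∈ petalDomain R := by
  have := Complex.norm_le_abs_re_add_abs_im w
  rw [abs_of_nonneg hw] at this
  exact hR.trans_le this

/-- The sector `|arg| ≥ 3π/4` is where `re + |im| ≤ 0`, since `sin t + cos t = √2 sin (t + π/4)`.
The remaining margin `π/4` before the cut is what keeps `f` on one branch. -/
theorem abs_arg_lt_of_mem_petalDomain {R : ℝ} (hR : 0 ≤ R) {w : ℂ} (hw : w ∈ petalDomain R) :
    |w.arg| < 3 * Real.pi / 4 := by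
  have hw0 := norm_pos_iff.2 (ne_zero_of_mem_petalDomain hR hw)
  have hw : R < w.re + |w.im| := hw
  by_contra! hle
  have habs : |w.im| = ‖w‖ * Real.sin |w.arg| := by
    rw [← Complex.norm_mul_sin_arg w, abs_mul, abs_of_pos hw0]
    congr 1
    rcases le_total 0 w.arg with h | h
    · rw [abs_of_nonneg h, abs_of_nonneg (Real.sin_nonneg_of_nonneg_of_le_pi h (Complex.arg_le_pi w))]
    · rw [abs_of_nonpos h, abs_of_nonpos (Real.sin_nonpos_of_nonpos_of_neg_pi_le h
        (Complex.neg_pi_lt_arg w).le), Real.sin_neg]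
  have hre : w.re = ‖w‖ * Real.cos |w.arg| := by rw [Real.cos_abs, Complex.norm_mul_cos_arg]
  have hneg : Real.sin (|w.arg| + Real.pi / 4 - Real.pi) ≥ 0 :=
    Real.sin_nonneg_of_nonneg_of_le_pi (by linarith)
      (by linarith [Complex.abs_arg_le_pi w, Real.pi_pos])
  rw [Real.sin_sub_pi, Real.sin_add, Real.cos_pi_div_four, Real.sin_pi_div_four] at hneg
  have h2 : (0 : ℝ) < √2 / 2 := by positivity
  have h3 : Real.sin |w.arg| + Real.cos |w.arg| ≤ 0 := by
    by_contra! h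
    nlinarith
  nlinarith

/-- A step raises `re` by at least `1/2` and lowers `|im|` by at most `1/2`; the slope of the broken
line is chosen for this. -/
theorem mapsTo_petalDomain {F : ℂ → ℂ} {R : ℝ}
    (hF : ∀ w ∈ petalDomain R, ‖F w - w - 1‖ ≤ 1 / 2) :
    Set.MapsTo F (petalDomain R) (petalDomain R) := by
  intro w hw
  have h := hF w hw
  have h1 := (Complex.abs_re_le_norm _).trans h
  have h2 := (Complex.abs_im_le_norm _).trans h
  simp only [Complex.sub_re, Complex.one_re, Complex.sub_im, Complex.one_im, sub_zero] at h1 h2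
  have h3 := abs_sub_abs_le_abs_sub w.im (F w).im
  rw [abs_sub_comm] at h3
  have hw : R < w.re + |w.im| := hw
  exact show R < (F w).re + |(F w).im| by linarith [(abs_le.1 h1).1]

/-- A sequence with increments tending to `1` tends to infinity in the positive direction. -/
theorem tendsto_arg_of_tendsto_sub_one {u : ℕ → ℂ}
    (hu : Filter.Tendsto (fun n => u (n + 1) - u n) Filter.atTop (𝓝 1)) :
    Filter.Tendsto (fun n => (u n).arg) Filter.atTop (𝓝 0) := by
  -- Averaging the increments gives `u n / n → 1`, and division by `n > 0` does not change the
  -- argument.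
  have h1 := hu.cesaro_smul
  have h2 : Filter.Tendsto (fun n : ℕ => (n : ℝ)⁻¹ • u n) Filter.atTop (𝓝 1) := by
    have h0 : Filter.Tendsto (fun n : ℕ => (n : ℝ)⁻¹ • u 0) Filter.atTop (𝓝 0) := by
      simpa using (tendsto_inv_atTop_nhds_zero_nat (𝕜 := ℝ)).smul_const (u 0)
    have := h1.add h0
    rw [add_zero] at this
    refine this.congr fun n => ?_
    rw [Finset.sum_range_sub, ← smul_add, sub_add_cancel]
  have h3 := (Complex.continuousAt_arg Complex.one_mem_slitPlane).tendsto.comp h2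
  rw [Complex.arg_one] at h3
  refine h3.congr' ((Filter.eventually_gt_atTop 0).mono fun n hn => ?_)
  simp only [Function.comp, Complex.real_smul]
  exact Complex.arg_real_mul _ (by positivity)

theorem tendsto_norm_iterate_atTop {F : ℂ → ℂ} {R : ℝ}
    (hF : ∀ w ∈ petalDomain R, ‖F w - w - 1‖ ≤ 1 / 2) {w : ℂ} (hw : w ∈ petalDomain R) :
    Filter.Tendsto (fun n => ‖F^[n] w‖) Filter.atTop Filter.atTop := by
  refine Filter.tendsto_atTop_mono (fun n => (re_iterate_ge (mapsTo_petalDomain hF) hF hw n).trans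
    (Complex.re_le_norm _)) ?_
  exact Filter.tendsto_atTop_add_const_left _ _
    (tendsto_natCast_atTop_atTop.atTop_div_const two_pos)

theorem tendsto_arg_iterate {F : ℂ → ℂ} {R C s : ℝ} (hs : 0 < s)
    (hF : ∀ w ∈ petalDomain R, ‖F w - w - 1‖ ≤ 1 / 2)
    (hb : ∀ w ∈ petalDomain R, ‖F w - w - 1‖ ≤ C * ‖w‖ ^ (-s)) {w : ℂ} (hw : w ∈ petalDomain R) :
    Filter.Tendsto (fun n => (F^[n] w).arg) Filter.atTop (𝓝 0) := by
  refine tendsto_arg_of_tendsto_sub_one ?_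
  have h0 : Filter.Tendsto (fun n => F (F^[n] w) - F^[n] w - 1) Filter.atTop (𝓝 0) := by
    refine squeeze_zero_norm (fun n => hb _ ((mapsTo_petalDomain hF).iterate n hw)) ?_
    simpa using ((tendsto_rpow_neg_atTop hs).comp (tendsto_norm_iterate_atTop hF hw)).const_mul C
  refine (tendsto_sub_nhds_zero_iff.1 h0).congr fun n => ?_
  rw [Function.iterate_succ_apply']

/-! ### Directions, the coordinate and its inverse branches. -/

theorem isAttractingDirection_iff {a : ℂ} (ha : a ≠ 0) {p : ℕ} {v : ℂ} :
    IsAttractingDirection a p v ↔ ‖v‖ = 1 ∧ a * v ^ p = -(‖a‖ : ℂ) := by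
  have ha' : (‖a‖ : ℂ) ≠ 0 := by simpa using ha
  refine and_congr_right fun hv => ⟨?_, fun h => ⟨-1, by norm_num, ?_⟩⟩
  · rintro ⟨r, hr, h⟩
    have h1 := congrArg norm h
    rw [norm_div, norm_mul, norm_pow, hv, one_pow, mul_one, Complex.norm_real, norm_norm,
      div_self (norm_ne_zero_iff.2 ha), Complex.norm_real, Real.norm_of_nonpos hr.le] at h1
    obtain rfl : r = -1 := by linarith
    rw [div_eq_iff ha'] at h
    simpa using h
  · rw [h, neg_div, div_self ha']
    simp

theorem isRepellingDirection_iff {a : ℂ} {p : ℕ} {v : ℂ} :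
    IsRepellingDirection a p v ↔ IsAttractingDirection (-a) p v := by
  refine and_congr_right fun _ => ⟨?_, ?_⟩
  · rintro ⟨r, hr, h⟩
    exact ⟨-r, by linarith, by rw [norm_neg, neg_mul, neg_div, h, Complex.ofReal_neg]⟩
  · rintro ⟨r, hr, h⟩
    refine ⟨-r, by linarith, ?_⟩
    rw [norm_neg, neg_mul, neg_div] at h
    rw [Complex.ofReal_neg, ← h, neg_neg]

/-- The coordinate `-1 / (p a z ^ p)`, in which `z + a z ^ (p + 1) + ⋯` is close to the translation
by `1`. -/
noncomputable def petalChart (a : ℂ) (p : ℕ) (z : ℂ) : ℂ := -1 / (p * a * z ^ p)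

/-- The branch of the inverse of `petalChart a p` on the slit plane that takes values in the sector
bisected by the attracting direction `v`. -/
noncomputable def petalBranch (a : ℂ) (p : ℕ) (v w : ℂ) : ℂ :=
  v * Complex.exp (-(Complex.log w + (Real.log (p * ‖a‖) : ℝ)) / p)

section Chart

variable {a v w : ℂ} {p : ℕ}

theorem petalChart_neg (z : ℂ) : petalChart (-a) p z = -petalChart a p z := by
  simp only [petalChart, mul_neg, neg_mul, div_neg]

theorem petalBranch_exp {ζ : ℂ} (hζ : |ζ.im| < Real.pi) :
    petalBranch a p v (Complex.exp ζ) =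
      v * Complex.exp (-(ζ + (Real.log (p * ‖a‖) : ℝ)) / p) := by
  rw [petalBranch, Complex.log_exp (abs_lt.1 hζ).1 (abs_lt.1 hζ).2.le]

theorem exp_ofReal_log (ha : a ≠ 0) (hp : p ≠ 0) :
    Complex.exp (Real.log (p * ‖a‖) : ℝ) = p * ‖a‖ := by
  have h : 0 < p * ‖a‖ := mul_pos (by positivity) (norm_pos_iff.2 ha)
  rw [← Complex.ofReal_exp, Real.exp_log h]
  push_cast
  rfl

theorem petalChart_mul_exp (ha : a ≠ 0) (hp : p ≠ 0) (hv : IsAttractingDirection a p v) (ℓ : ℂ) :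
    petalChart a p (v * Complex.exp ℓ) =
      Complex.exp (-(p * ℓ) - (Real.log (p * ‖a‖) : ℝ)) := by
  rw [isAttractingDirection_iff ha] at hv
  rw [petalChart, mul_pow, ← Complex.exp_nat_mul, sub_eq_add_neg, Complex.exp_add, Complex.exp_neg,
    Complex.exp_neg, exp_ofReal_log ha hp,
    show (p : ℂ) * a * (v ^ p * Complex.exp (p * ℓ)) = p * (a * v ^ p) * Complex.exp (p * ℓ) by ring,
    hv.2]
  have ha' : (‖a‖ : ℂ) ≠ 0 := by simpa using ha
  have hp' : (p : ℂ) ≠ 0 := by exact_mod_cast hp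
  have := Complex.exp_ne_zero (p * ℓ)
  field_simp

theorem petalChart_petalBranch (ha : a ≠ 0) (hp : p ≠ 0) (hv : IsAttractingDirection a p v)
    (hw : w ≠ 0) : petalChart a p (petalBranch a p v w) = w := by
  have hp' : (p : ℂ) ≠ 0 := by exact_mod_cast hp
  rw [petalBranch, petalChart_mul_exp ha hp hv, mul_div_cancel₀ _ hp', neg_neg, add_sub_cancel_right,
    Complex.exp_log hw]

theorem petalBranch_ne_zero (hv : ‖v‖ = 1) : petalBranch a p v w ≠ 0 :=
  mul_ne_zero (norm_ne_zero_iff.1 (by rw [hv]; exact one_ne_zero)) (Complex.exp_ne_zero _)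

theorem norm_petalBranch (ha : a ≠ 0) (hp : p ≠ 0) (hv : ‖v‖ = 1) (hw : w ≠ 0) :
    ‖petalBranch a p v w‖ = (p * ‖a‖) ^ (-(1 / p : ℝ)) * ‖w‖ ^ (-(1 / p : ℝ)) := by
  have h : 0 < p * ‖a‖ := mul_pos (by positivity) (norm_pos_iff.2 ha)
  rw [petalBranch, norm_mul, hv, one_mul, Complex.norm_exp, Complex.div_natCast_re,
    Complex.neg_re, Complex.add_re, Complex.log_re, Complex.ofReal_re,
    Real.rpow_def_of_pos h, Real.rpow_def_of_pos (norm_pos_iff.2 hw), ← Real.exp_add]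
  congr 1
  ring

theorem petalBranch_div_norm (hv : ‖v‖ = 1) :
    petalBranch a p v w / (‖petalBranch a p v w‖ : ℂ) =
      v * Complex.exp ((-(w.arg / p) : ℝ) * Complex.I) := by
  rw [petalBranch, norm_mul, hv, one_mul, Complex.norm_exp, Complex.ofReal_exp, mul_div_assoc,
    ← Complex.exp_sub]
  congr 2
  apply Complex.ext
  · simp
  · simp [Complex.log_im, neg_div]

theorem continuousOn_petalBranch : ContinuousOn (petalBranch a p v) Complex.slitPlane := by
  unfold petalBranch
  refine continuousOn_const.mul (Complex.continuous_exp.comp_continuousOn ?_)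
  exact ((((continuousOn_id.clog fun _ h => h).add continuousOn_const).neg).div_const _)

theorem differentiableOn_petalBranch :
    DifferentiableOn ℂ (petalBranch a p v) Complex.slitPlane := by
  unfold petalBranch
  intro z hz
  exact (((((differentiableAt_id.clog hz).add_const _).neg.div_const _).cexp).const_mul
    v).differentiableWithinAt

theorem differentiableAt_petalChart (ha : a ≠ 0) (hp : p ≠ 0) {z : ℂ} (hz : z ≠ 0) :
    DifferentiableAt ℂ (petalChart a p) z := by
  unfold petalChart
  have hp' : (p : ℂ) ≠ 0 := by exact_mod_cast hp
  exact (differentiableAt_const _).div ((differentiableAt_id.pow p).const_mul _)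
    (mul_ne_zero (mul_ne_zero hp' ha) (pow_ne_zero _ hz))

/-- Dividing `z` by the exponential factor `e` of the branch leaves the only possible `v`; it is an
attracting direction because `e^p` is the inverse of `p ‖a‖` times the coordinate of `z`. -/
theorem exists_petalBranch_eq (ha : a ≠ 0) (hp : p ≠ 0) {z : ℂ} (hz : z ≠ 0) :
    ∃ v, IsAttractingDirection a p v ∧ petalBranch a p v (petalChart a p z) = z := by
  have hp' : (p : ℂ) ≠ 0 := by exact_mod_cast hp
  have ha' : (‖a‖ : ℂ) ≠ 0 := by simpa using ha
  have hw : petalChart a p z ≠ 0 := by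
    rw [petalChart]
    exact div_ne_zero (by norm_num) (mul_ne_zero (mul_ne_zero hp' ha) (pow_ne_zero _ hz))
  set e := Complex.exp (-(Complex.log (petalChart a p z) + (Real.log (p * ‖a‖) : ℝ)) / p) with he
  have he0 : e ≠ 0 := Complex.exp_ne_zero _
  have hep : e ^ p * (petalChart a p z * (p * ‖a‖)) = 1 := by
    rw [he, ← Complex.exp_nat_mul, mul_div_cancel₀ _ hp', Complex.exp_neg, Complex.exp_add,
      Complex.exp_log hw, exp_ofReal_log ha hp]
    exact inv_mul_cancel₀ (mul_ne_zero hw (mul_ne_zero hp' ha'))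
  have hav : a * (z / e) ^ p = -(‖a‖ : ℂ) := by
    rw [div_pow]
    have h2 := pow_ne_zero p he0
    have h3 := pow_ne_zero p hz
    rw [petalChart] at hep
    field_simp at hep ⊢
    linear_combination -hep
  refine ⟨z / e, (isAttractingDirection_iff ha).2 ⟨?_, hav⟩, div_mul_cancel₀ _ he0⟩
  have h1 := congrArg norm hav
  rw [norm_mul, norm_neg, Complex.norm_real, norm_norm, norm_pow,
    mul_eq_left₀ (norm_ne_zero_iff.2 ha)] at h1
  exact (pow_eq_one_iff_of_nonneg (norm_nonneg _) hp).1 h1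

theorem tendsto_norm_petalChart (ha : a ≠ 0) (hp : p ≠ 0) :
    Filter.Tendsto (fun z => ‖petalChart a p z‖) (𝓝[≠] 0) Filter.atTop := by
  have hp' : (p : ℂ) ≠ 0 := by exact_mod_cast hp
  have h1 : Filter.Tendsto (fun z : ℂ => p * a * z ^ p) (𝓝[≠] 0) (𝓝[≠] 0) := by
    refine tendsto_nhdsWithin_iff.2 ⟨?_, eventually_mem_nhdsWithin.mono fun z hz =>
      mul_ne_zero (mul_ne_zero hp' ha) (pow_ne_zero _ hz)⟩
    have : Continuous fun z : ℂ => p * a * z ^ p := by fun_prop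
    simpa [hp] using (this.tendsto 0).mono_left nhdsWithin_le_nhds
  refine (tendsto_norm_inv_nhdsNE_zero_atTop.comp h1).congr fun z => ?_
  simp [petalChart]

end Chart

/-! ### The germ in the coordinate is close to a translation. -/

theorem isBigO_pow_pow_of_le {m n : ℕ} (h : n ≤ m) :
    (fun z : ℂ => z ^ m) =O[𝓝 0] fun z : ℂ => z ^ n := by
  refine IsBigO.of_bound 1 ?_
  filter_upwards [Metric.closedBall_mem_nhds (0 : ℂ) one_pos] with z hz
  rw [one_mul, norm_pow, norm_pow]
  exact pow_le_pow_of_le_one (norm_nonneg _) (by simpa using hz) h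

/-- A germ `z + a z ^ (p + 1) + ⋯` is `z ↦ z * exp (L z)` with `L z = a z ^ p + ⋯`. -/
theorem HasExpansion.exists_log {f : ℂ → ℂ} {a : ℂ} {p : ℕ} (hf : HasExpansion f a p)
    (ha : a ≠ 0) (hp : p ≠ 0) :
    ∃ L : ℂ → ℂ, Filter.Tendsto L (𝓝[≠] 0) (𝓝 0) ∧
      (∀ᶠ z in 𝓝[≠] (0 : ℂ), f z = z * Complex.exp (L z)) ∧
      (fun z => petalChart a p z * Complex.exp (-(p * L z)) - petalChart a p z - 1)
        =O[𝓝[≠] 0] fun z : ℂ => z := by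
  have hp' : (p : ℂ) ≠ 0 := by exact_mod_cast hp
  have hne : ∀ᶠ z in 𝓝[≠] (0 : ℂ), z ≠ 0 := eventually_mem_nhdsWithin
  have hpow : ∀ {m n : ℕ}, n ≤ m → (fun z : ℂ => z ^ m) =O[𝓝[≠] 0] fun z : ℂ => z ^ n :=
    fun h => (isBigO_pow_pow_of_le h).mono nhdsWithin_le_nhds
  set η : ℂ → ℂ := fun z => f z / z - 1 with hη
  have h1 : (fun z => η z - a * z ^ p) =O[𝓝[≠] 0] fun z : ℂ => z ^ (p + 1) := by
    refine ((hf.mono nhdsWithin_le_nhds).mul (isBigO_refl (fun z : ℂ => z⁻¹) _)).congr'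
      (hne.mono fun z hz => ?_) (hne.mono fun z hz => ?_)
    · simp only [hη]
      field_simp
      ring
    · field_simp
      ring
  have hap : (fun z : ℂ => a * z ^ p) =O[𝓝[≠] 0] fun z : ℂ => z ^ p :=
    (isBigO_refl _ _).const_mul_left a
  have hz0 : Filter.Tendsto (fun z : ℂ => z ^ p) (𝓝[≠] 0) (𝓝 0) := by
    have : Continuous fun z : ℂ => z ^ p := by fun_prop
    simpa [hp] using (this.tendsto 0).mono_left nhdsWithin_le_nhds
  have h2 : η =O[𝓝[≠] 0] fun z : ℂ => z ^ p :=
    ((h1.trans (hpow p.le_succ)).add hap).congr_left fun z => by ring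
  have hη0 := h2.trans_tendsto hz0
  have hsq : ∀ {u : ℂ → ℂ}, u =O[𝓝[≠] 0] (fun z : ℂ => z ^ p) →
      (fun z => u z ^ 2) =O[𝓝[≠] 0] fun z : ℂ => z ^ (p + 1) := fun hu =>
    ((hu.pow 2).congr_right fun z => (pow_mul z p 2).symm).trans (hpow (by omega))
  set L : ℂ → ℂ := fun z => Complex.log (1 + η z) with hL
  have h3 : (fun z => L z - η z) =O[𝓝[≠] 0] fun z : ℂ => z ^ (p + 1) :=
    (Complex.log_sub_self_isBigO.comp_tendsto hη0).trans (hsq h2)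
  have h4 : (fun z => L z - a * z ^ p) =O[𝓝[≠] 0] fun z : ℂ => z ^ (p + 1) :=
    (h3.add h1).congr_left fun z => by ring
  have h5 : L =O[𝓝[≠] 0] fun z : ℂ => z ^ p :=
    ((h4.trans (hpow p.le_succ)).add hap).congr_left fun z => by ring
  have hL0 := h5.trans_tendsto hz0
  refine ⟨L, hL0, ?_, ?_⟩
  · have h6 : ∀ᶠ z in 𝓝[≠] (0 : ℂ), 1 + η z ≠ 0 :=
      (hη0.const_add 1).eventually_ne (by simp)
    filter_upwards [h6, hne] with z hz hz0
    rw [hL]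
    dsimp only
    rw [Complex.exp_log hz, hη]
    field_simp
    ring
  · have h7 : (fun x : ℂ => Complex.exp x - 1 - x) =O[𝓝 0] fun x : ℂ => x ^ 2 := by
      refine IsBigO.of_bound 1 ?_
      filter_upwards [Metric.closedBall_mem_nhds (0 : ℂ) one_pos] with x hx
      rw [one_mul, norm_pow]
      exact Complex.norm_exp_sub_one_sub_id_le (by simpa using hx)
    have h8 : (fun z => -(p * L z)) =O[𝓝[≠] 0] fun z : ℂ => z ^ p :=
      (h5.const_mul_left (p : ℂ)).neg_left
    -- `exp(-p L) = 1 - p a z^p + O(z^(p+1))`; multiplying by the coordinate, of size `z^(-p)`,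
    -- turns the middle term into exactly `1` and the error into `O(z)`.
    have h9 : (fun z => Complex.exp (-(p * L z)) - 1 + p * (a * z ^ p))
        =O[𝓝[≠] 0] fun z : ℂ => z ^ (p + 1) :=
      (((h7.comp_tendsto (h8.trans_tendsto hz0)).trans (hsq h8)).sub
        (h4.const_mul_left (p : ℂ))).congr_left fun z => by
          simp only [Function.comp]
          ring
    have h10 : (petalChart a p) =O[𝓝[≠] 0] fun z : ℂ => (z ^ p)⁻¹ :=
      ((isBigO_refl (fun z : ℂ => (z ^ p)⁻¹) _).const_mul_left (-1 / (p * a))).congr_left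
        fun z => by
          rw [petalChart, ← div_eq_mul_inv, div_div]
    refine (h10.mul h9).congr' (hne.mono fun z hz => ?_) (hne.mono fun z hz => ?_)
    · have h11 : petalChart a p z * (p * (a * z ^ p)) = -1 := by
        rw [petalChart]
        field_simp
      linear_combination h11
    · field_simp
      ring

/-- In the coordinate `petalChart a p`, on the branch belonging to `v`, the map `f` is close to the
translation by `1` on `petalDomain R`. -/
structure IsNearTranslation (f : ℂ → ℂ) (s : Set ℂ) (a : ℂ) (p : ℕ) (v : ℂ) (C R : ℝ) : Prop where
  branch_mem : ∀ w ∈ petalDomain R, petalBranch a p v w ∈ s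
  branch_map : ∀ w ∈ petalDomain R,
    petalBranch a p v (petalChart a p (f (petalBranch a p v w))) = f (petalBranch a p v w)
  norm_le_half : ∀ w ∈ petalDomain R,
    ‖petalChart a p (f (petalBranch a p v w)) - w - 1‖ ≤ 1 / 2
  norm_le : ∀ w ∈ petalDomain R,
    ‖petalChart a p (f (petalBranch a p v w)) - w - 1‖ ≤ C * ‖w‖ ^ (-(1 / p : ℝ))

/-- The error `O(z)` becomes `O(|w|^(-1/p))` because `|z|` is a constant times `|w|^(-1/p)` on every
branch; hence `C` and `R` do not depend on `v`. -/
theorem HasExpansion.exists_isNearTranslation {f : ℂ → ℂ} {a : ℂ} {p : ℕ}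
    (hf : HasExpansion f a p) (ha : a ≠ 0) (hp : p ≠ 0) {s : Set ℂ} (hs : s ∈ 𝓝 (0 : ℂ)) :
    ∃ C R : ℝ, 0 ≤ C ∧ 0 < R ∧
      ∀ v, IsAttractingDirection a p v → IsNearTranslation f s a p v C R := by
  obtain ⟨L, hL0, hfL, hO⟩ := hf.exists_log ha hp
  obtain ⟨C₀, hC₀, hO⟩ := hO.exists_pos
  have hp0 : (0 : ℝ) < 1 / p := by positivity
  have hp' : (p : ℂ) ≠ 0 := by exact_mod_cast hp
  have h1 : ∀ᶠ z in 𝓝[≠] (0 : ℂ), |(p * L z).im| < Real.pi / 4 := by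
    have h : Filter.Tendsto (fun z => |(p * L z).im|) (𝓝[≠] 0) (𝓝 0) := by
      simpa using
        (((Complex.continuous_im.tendsto _).comp (hL0.const_mul (p : ℂ))).abs)
    exact h.eventually (gt_mem_nhds (by positivity))
  have h2 : ∀ᶠ z in 𝓝[≠] (0 : ℂ), C₀ * ‖z‖ < 1 / 2 := by
    have h : Filter.Tendsto (fun z : ℂ => C₀ * ‖z‖) (𝓝 0) (𝓝 0) := by
      simpa using (continuous_norm.tendsto (0 : ℂ)).const_mul C₀
    exact (h.mono_left nhdsWithin_le_nhds).eventually (gt_mem_nhds (by norm_num))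
  have hs' : ∀ᶠ z in 𝓝[≠] (0 : ℂ), z ∈ s := mem_nhdsWithin_of_mem_nhds hs
  obtain ⟨δ, hδ, hall⟩ := Metric.mem_nhdsWithin_iff.1
    ((hs'.and hfL).and ((h1.and h2).and hO.bound))
  set c : ℝ := (p * ‖a‖) ^ (-(1 / p : ℝ)) with hc
  have hc0 : 0 ≤ c := by positivity
  -- On the domain `‖w‖ > R / 2`, so this puts `z` in the ball of radius `δ` where all the estimates
  -- hold.
  obtain ⟨R, hRδ, hR0⟩ : ∃ R : ℝ, c * (R / 2) ^ (-(1 / p : ℝ)) < δ ∧ 0 < R := by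
    have h : Filter.Tendsto (fun R : ℝ => c * (R / 2) ^ (-(1 / p : ℝ))) Filter.atTop (𝓝 0) := by
      simpa using ((tendsto_rpow_neg_atTop hp0).comp
        (Filter.tendsto_id.atTop_div_const (two_pos : (0 : ℝ) < 2))).const_mul c
    exact ((h.eventually (gt_mem_nhds hδ)).and (Filter.eventually_gt_atTop 0)).exists
  refine ⟨C₀ * c, R, by positivity, hR0, fun v hv => ?_⟩
  have key : ∀ w ∈ petalDomain R, petalBranch a p v w ∈ s ∧
      petalBranch a p v (petalChart a p (f (petalBranch a p v w))) = f (petalBranch a p v w) ∧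
      ‖petalChart a p (f (petalBranch a p v w)) - w - 1‖ ≤ C₀ * ‖petalBranch a p v w‖ ∧
      C₀ * ‖petalBranch a p v w‖ < 1 / 2 := by
    intro w hw
    have hw0 := ne_zero_of_mem_petalDomain hR0.le hw
    have hz0 : petalBranch a p v w ≠ 0 := petalBranch_ne_zero hv.1
    have hzδ : ‖petalBranch a p v w‖ < δ := by
      rw [norm_petalBranch ha hp hv.1 hw0]
      refine lt_of_le_of_lt (mul_le_mul_of_nonneg_left ?_ hc0) hRδ
      exact Real.rpow_le_rpow_of_nonpos (by positivity) (lt_norm_of_mem_petalDomain hw).le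
        (by linarith)
    obtain ⟨⟨hzs, hfz⟩, ⟨him, hhalf⟩, hbound⟩ := hall ⟨mem_ball_zero_iff.2 hzδ, Set.mem_compl_singleton_iff.2 hz0⟩
    set z := petalBranch a p v w with hz
    have hexp : Complex.exp (Complex.log w - p * L z) = w * Complex.exp (-(p * L z)) := by
      rw [sub_eq_add_neg, Complex.exp_add, Complex.exp_log hw0]
    -- `3π/4 + π/4 = π`: the logarithm stays principal, so `f z` lies on the same branch as `z`.
    have hζ : |(Complex.log w - p * L z).im| < Real.pi := by
      rw [Complex.sub_im, Complex.log_im]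
      have := abs_sub w.arg (p * L z).im
      linarith [abs_arg_lt_of_mem_petalDomain hR0.le hw]
    have hgz : petalBranch a p v (w * Complex.exp (-(p * L z))) = f z := by
      rw [← hexp, petalBranch_exp hζ, hfz, hz, petalBranch, mul_assoc, ← Complex.exp_add]
      congr 2
      rw [← petalBranch, ← hz]
      field_simp
      ring
    have hFw : petalChart a p (f z) = w * Complex.exp (-(p * L z)) := by
      rw [← hgz, petalChart_petalBranch ha hp hv (mul_ne_zero hw0 (Complex.exp_ne_zero _))]
    have hchart : petalChart a p z = w := petalChart_petalBranch ha hp hv hw0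
    refine ⟨hzs, by rw [hFw, hgz], ?_, hhalf⟩
    rw [hFw]
    rwa [hchart] at hbound
  refine ⟨fun w hw => (key w hw).1, fun w hw => (key w hw).2.1,
    fun w hw => (key w hw).2.2.1.trans (key w hw).2.2.2.le, fun w hw => ?_⟩
  have := (key w hw).2.2.1
  rwa [norm_petalBranch ha hp hv.1 (ne_zero_of_mem_petalDomain hR0.le hw), ← mul_assoc] at this

/-! ### Images of the branches. -/

theorem mem_slitPlane_of_mem_petalDomain {R : ℝ} (hR : 0 ≤ R) {w : ℂ} (hw : w ∈ petalDomain R) :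
    w ∈ Complex.slitPlane := by
  refine Complex.mem_slitPlane_iff_arg.2 ⟨fun h => ?_, ne_zero_of_mem_petalDomain hR hw⟩
  have := abs_arg_lt_of_mem_petalDomain hR hw
  rw [h, abs_of_pos Real.pi_pos] at this
  linarith [Real.pi_pos]

section Branch

variable {a v : ℂ} {p : ℕ}

theorem isOpen_petalBranch_image (hp : p ≠ 0) (hv : ‖v‖ = 1) {D : Set ℂ} (hD : IsOpen D)
    (hDs : D ⊆ Complex.slitPlane) : IsOpen (petalBranch a p v '' D) := by
  rw [isOpen_iff_mem_nhds]
  rintro _ ⟨w, hw, rfl⟩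
  have hp' : (p : ℂ) ≠ 0 := by exact_mod_cast hp
  have hd : HasStrictDerivAt (petalBranch a p v) _ w :=
    (((((Complex.hasStrictDerivAt_log (hDs hw)).add_const _).neg).div_const (p : ℂ)).cexp).const_mul v
  rw [← hd.map_nhds_eq ?_]
  · exact Filter.image_mem_map (hD.mem_nhds hw)
  · refine mul_ne_zero (norm_ne_zero_iff.1 (by rw [hv]; exact one_ne_zero))
      (mul_ne_zero (Complex.exp_ne_zero _) (div_ne_zero (neg_ne_zero.2 (inv_ne_zero ?_)) hp'))
    exact Complex.slitPlane_ne_zero (hDs hw)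

theorem isSimplyConnected_petalBranch_image (ha : a ≠ 0) (hp : p ≠ 0)
    (hv : IsAttractingDirection a p v) {D : Set ℂ} (hD : IsSimplyConnected D)
    (hDs : D ⊆ Complex.slitPlane) : IsSimplyConnected (petalBranch a p v '' D) := by
  have hinv : ∀ w ∈ D, petalChart a p (petalBranch a p v w) = w := fun w hw =>
    petalChart_petalBranch ha hp hv (Complex.slitPlane_ne_zero (hDs hw))
  let e : D ≃ₜ (petalBranch a p v '' D) :=
    { toFun := fun w => ⟨petalBranch a p v w, w, w.2, rfl⟩
      invFun := fun z => ⟨petalChart a p z, by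
        obtain ⟨_, w, hw, rfl⟩ := z
        rw [hinv w hw]
        exact hw⟩
      left_inv := fun w => Subtype.ext (hinv w w.2)
      right_inv := by
        rintro ⟨_, w, hw, rfl⟩
        exact Subtype.ext (congrArg (petalBranch a p v) (hinv w hw))
      continuous_toFun := Continuous.subtype_mk
        ((continuousOn_petalBranch.mono hDs).comp_continuous continuous_subtype_val
          Subtype.prop) _
      continuous_invFun := by
        refine Continuous.subtype_mk (continuous_iff_continuousAt.2 ?_) _
        rintro ⟨_, w, hw, rfl⟩
        exact ContinuousAt.comp (f := Subtype.val) (g := petalChart a p)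
          (differentiableAt_petalChart ha hp (petalBranch_ne_zero hv.1)).continuousAt
          continuousAt_subtype_val }
  exact e.toHomotopyEquiv.simplyConnectedSpace_iff.1 hD

theorem tendsto_petalBranch_zero (ha : a ≠ 0) (hp : p ≠ 0) (hv : ‖v‖ = 1) {u : ℕ → ℂ}
    (hu : Filter.Tendsto (fun n => ‖u n‖) Filter.atTop Filter.atTop) :
    Filter.Tendsto (fun n => petalBranch a p v (u n)) Filter.atTop (𝓝 0) := by
  have hp0 : (0 : ℝ) < 1 / p := by positivity
  have h := ((tendsto_rpow_neg_atTop hp0).comp hu).const_mul ((p * ‖a‖) ^ (-(1 / p : ℝ)))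
  rw [mul_zero] at h
  refine tendsto_zero_iff_norm_tendsto_zero.2 (h.congr' ?_)
  filter_upwards [hu.eventually (Filter.eventually_gt_atTop 0)] with n hn
  rw [norm_petalBranch ha hp hv (norm_pos_iff.1 hn)]
  rfl

/-- A sequence tending to `0` in the direction `v` lies on the branch belonging to `v`, at points
whose coordinates move to the right. -/
theorem eventually_mem_petalBranch_image (ha : a ≠ 0) (hp : p ≠ 0)
    (hv : IsAttractingDirection a p v) {u : ℕ → ℂ} (hu : Filter.Tendsto u Filter.atTop (𝓝 0))
    (huv : Filter.Tendsto (fun n => u n / (‖u n‖ : ℂ)) Filter.atTop (𝓝 v)) (R : ℝ) :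
    ∀ᶠ n in Filter.atTop, u n ∈ petalBranch a p v '' {w | R < w.re} := by
  have hv0 : v ≠ 0 := norm_ne_zero_iff.1 (by rw [hv.1]; exact one_ne_zero)
  have hp' : (p : ℂ) ≠ 0 := by exact_mod_cast hp
  have hu0 : ∀ᶠ n in Filter.atTop, u n ≠ 0 := by
    filter_upwards [huv.eventually_ne hv0] with n hn h
    simp [h] at hn
  have harg : Filter.Tendsto (fun n => p * (u n / v).arg) Filter.atTop (𝓝 0) := by
    have h1 : Filter.Tendsto (fun n => u n / (‖u n‖ : ℂ) / v) Filter.atTop (𝓝 1) := by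
      simpa [hv0] using huv.div_const v
    have h2 := ((Complex.continuousAt_arg Complex.one_mem_slitPlane).tendsto.comp h1).const_mul
      (p : ℝ)
    rw [Complex.arg_one, mul_zero] at h2
    refine h2.congr' (hu0.mono fun n hn => ?_)
    dsimp only [Function.comp]
    rw [show u n / (‖u n‖ : ℂ) / v = ((‖u n‖⁻¹ : ℝ) : ℂ) * (u n / v) by push_cast; ring,
      Complex.arg_real_mul _ (by positivity)]
  have hnorm : Filter.Tendsto (fun n => ‖petalChart a p (u n)‖) Filter.atTop Filter.atTop :=
    (tendsto_norm_petalChart ha hp).comp (tendsto_nhdsWithin_iff.2 ⟨hu, hu0⟩)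
  -- This product is the real part of the coordinate of `u n`, whose argument is `-p arg (u n / v)`
  -- up to multiples of `2π`.
  have hre : Filter.Tendsto (fun n => ‖petalChart a p (u n)‖ * Real.cos (p * (u n / v).arg))
      Filter.atTop Filter.atTop :=
    hnorm.atTop_mul_pos one_pos
      (by simpa [Function.comp_def] using (Real.continuous_cos.tendsto 0).comp harg)
  filter_upwards [hu0, harg.abs.eventually (gt_mem_nhds (by simpa using Real.pi_pos)),
    hre.eventually (Filter.eventually_gt_atTop R)] with n hn hπ hR
  set ℓ := Complex.log (u n / v) with hℓ
  have huℓ : v * Complex.exp ℓ = u n := by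
    rw [hℓ, Complex.exp_log (div_ne_zero hn hv0), mul_div_cancel₀ _ hv0]
  have hw := petalChart_mul_exp ha hp hv ℓ
  rw [huℓ] at hw
  have him : (-(p * ℓ) - ((Real.log (p * ‖a‖) : ℝ) : ℂ)).im = -(p * (u n / v).arg) := by
    simp [hℓ, Complex.log_im]
  refine ⟨petalChart a p (u n), ?_, ?_⟩
  · refine Set.mem_ofPred_eq ▸ ?_
    rw [hw, Complex.norm_exp] at hR
    rw [hw, Complex.exp_re, him, Real.cos_neg]
    exact hR
  · rw [hw, petalBranch_exp (by rw [him, abs_neg]; exact hπ), sub_add_cancel, neg_neg,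
      mul_div_cancel_left₀ _ hp', huℓ]

end Branch

/-! ### Petals and conjugacy at one direction. -/

theorem IsNearTranslation.semiconj_iterate {f : ℂ → ℂ} {s : Set ℂ} {a v : ℂ} {p : ℕ} {C R : ℝ}
    (h : IsNearTranslation f s a p v C R) {w : ℂ} (hw : w ∈ petalDomain R) (n : ℕ) :
    f^[n] (petalBranch a p v w) =
      petalBranch a p v ((fun w => petalChart a p (f (petalBranch a p v w)))^[n] w) := by
  induction n with
  | zero => rfl
  | succ n ih =>
    rw [Function.iterate_succ_apply', Function.iterate_succ_apply', ih,
      h.branch_map _ ((mapsTo_petalDomain h.norm_le_half).iterate n hw)]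

theorem IsNearTranslation.isAttractingPetal {f : OpenPartialHomeomorph ℂ ℂ} {a v : ℂ} {p : ℕ}
    {C R : ℝ} (h : IsNearTranslation f f.source a p v C R) (ha : a ≠ 0) (hp : p ≠ 0) (hR : 0 < R)
    (hv : IsAttractingDirection a p v) :
    IsAttractingPetal f v (petalBranch a p v '' petalDomain R) := by
  have hslit : petalDomain R ⊆ Complex.slitPlane := fun w hw =>
    mem_slitPlane_of_mem_petalDomain hR.le hw
  have hopen := isOpen_petalBranch_image (a := a) hp hv.1 (isOpen_petalDomain R) hslit
  have hmaps := mapsTo_petalDomain h.norm_le_half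
  refine ⟨hopen, isSimplyConnected_petalBranch_image ha hp hv (isSimplyConnected_petalDomain R)
    hslit, ?_, ?_, ?_, ?_, ?_⟩
  · rintro _ ⟨w, hw, rfl⟩
    exact h.branch_mem w hw
  · rw [frontier, hopen.interior_eq]
    refine ⟨?_, ?_⟩
    · have hw : ((R + 1 : ℝ) : ℂ) ∈ petalDomain R := by simp [petalDomain]
      exact mem_closure_of_tendsto
        (tendsto_petalBranch_zero ha hp hv.1 (tendsto_norm_iterate_atTop h.norm_le_half hw))
        (Filter.Eventually.of_forall fun n => ⟨_, hmaps.iterate n hw, rfl⟩)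
    · rintro ⟨w, -, hw⟩
      exact petalBranch_ne_zero hv.1 hw
  · rintro _ ⟨w, hw, rfl⟩
    exact ⟨_, hmaps hw, h.branch_map w hw⟩
  · rintro _ ⟨w, hw, rfl⟩
    exact (tendsto_petalBranch_zero ha hp hv.1 (tendsto_norm_iterate_atTop h.norm_le_half hw)).congr
      fun n => (h.semiconj_iterate hw n).symm
  · rintro _ ⟨w, hw, rfl⟩
    have h1 := tendsto_arg_iterate (by positivity : (0 : ℝ) < 1 / p) h.norm_le_half h.norm_le hw
    have hcont : Continuous fun t : ℝ => v * Complex.exp ((-(t / p) : ℝ) * Complex.I) := by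
      fun_prop
    have h2 := (hcont.tendsto 0).comp h1
    simp only [zero_div, neg_zero, Complex.ofReal_zero, zero_mul, Complex.exp_zero, mul_one] at h2
    refine h2.congr fun n => ?_
    rw [h.semiconj_iterate hw n, petalBranch_div_norm hv.1]
    rfl

/-- A conjugation to the translation on a forward invariant open set `S` extends to every invariant
open set all of whose orbits meet `S`. -/
theorem isConjugateToTranslationOn_of_iterate_mem {f : OpenPartialHomeomorph ℂ ℂ}
    (hf : DifferentiableOn ℂ f f.source) {P S : Set ℂ} (hP : IsOpen P) (hPs : P ⊆ f.source)
    (hPf : Set.MapsTo f P P) (hS : IsOpen S) (hSf : Set.MapsTo f S S) {ψ : ℂ → ℂ}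
    (hψ : DifferentiableOn ℂ ψ S) (hinj : Set.InjOn ψ S) (hψf : ∀ z ∈ S, ψ (f z) = ψ z + 1)
    (hPS : ∀ z ∈ P, ∃ n, f^[n] z ∈ S) : IsConjugateToTranslationOn f P := by
  have hfP : DifferentiableOn ℂ f P := hf.mono hPs
  have hfn : ∀ n, DifferentiableOn ℂ f^[n] P := by
    intro n
    induction n with
    | zero => exact differentiableOn_id
    | succ n ih => exact ih.comp hfP hPf
  have hadd : ∀ {z n}, f^[n] z ∈ S → ∀ m, f^[n + m] z ∈ S ∧ ψ (f^[n + m] z) = ψ (f^[n] z) + m := by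
    intro z n hz m
    induction m with
    | zero => simpa using hz
    | succ m ih =>
      rw [← add_assoc, Function.iterate_succ_apply']
      refine ⟨hSf ih.1, ?_⟩
      rw [hψf _ ih.1, ih.2]
      push_cast
      ring
  choose! N hN using hPS
  set φ : ℂ → ℂ := fun z => ψ (f^[N z] z) - N z with hφ
  -- Independence of the entry time: near a point one fixed `n` serves, which gives holomorphy
  -- although `N` need not be continuous, and two points can be compared at a common time.
  have hφn : ∀ {z}, z ∈ P → ∀ {n}, f^[n] z ∈ S → φ z = ψ (f^[n] z) - n := by
    intro z hz n hn
    have h1 := (hadd (hN z hz) n).2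
    have h2 := (hadd hn (N z)).2
    rw [add_comm, h1] at h2
    linear_combination h2
  refine ⟨φ, fun z hz => ?_, fun z hz z' hz' heq => ?_, fun z hz => ?_⟩
  · have hd : DifferentiableAt ℂ (fun y => ψ (f^[N z] y) - N z) z :=
      ((hψ.differentiableAt (hS.mem_nhds (hN z hz))).comp z
        ((hfn _).differentiableAt (hP.mem_nhds hz))).sub_const _
    refine (hd.congr_of_eventuallyEq ?_).differentiableWithinAt
    have hc : ContinuousAt f^[N z] z := ((hfn _).differentiableAt (hP.mem_nhds hz)).continuousAt
    filter_upwards [hP.mem_nhds hz, hc (hS.mem_nhds (hN z hz))] with y hy hyS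
    exact hφn hy hyS
  · have h1 := hadd (hN z hz) (N z')
    have h2 := hadd (hN z' hz') (N z)
    rw [add_comm (N z')] at h2
    rw [hφn hz h1.1, hφn hz' h2.1] at heq
    have h3 := hinj h1.1 h2.1 (by linear_combination heq)
    exact (f.injOn.mono hPs).iterate hPf _ hz hz' h3
  · have h1 := hadd (hN z hz) 1
    have h2 : f^[N z] (f z) ∈ S := by
      rw [← Function.iterate_succ_apply]
      exact h1.1
    rw [hφn (hPf hz) h2, hφ, ← Function.iterate_succ_apply, h1.2]
    push_cast
    ring

/-- An arbitrary petal `P` need not lie in a branch image, but its orbits end up in the image of the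
half-plane carrying the Fatou coordinate, from where the conjugacy is pulled back. -/
theorem IsNearTranslation.isConjugateToTranslationOn {f : OpenPartialHomeomorph ℂ ℂ} {a v : ℂ}
    {p : ℕ} {C R : ℝ} (h : IsNearTranslation f f.source a p v C R)
    (hf : DifferentiableOn ℂ f f.source) (ha : a ≠ 0) (hp : p ≠ 0) (hC : 0 ≤ C) (hR : 0 < R)
    (hv : IsAttractingDirection a p v) {P : Set ℂ} (hP : IsAttractingPetal f v P) :
    IsConjugateToTranslationOn f P := by
  have hdom : ∀ {w : ℂ}, R < w.re → w ∈ petalDomain R := fun {w} hw =>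
    show R < w.re + |w.im| by linarith [abs_nonneg w.im]
  have hslit : ∀ {w : ℂ}, R < w.re → w ∈ Complex.slitPlane := fun hw =>
    mem_slitPlane_of_mem_petalDomain hR.le (hdom hw)
  set F : ℂ → ℂ := fun w => petalChart a p (f (petalBranch a p v w)) with hF
  have hFd : DifferentiableOn ℂ F {w | R < w.re} := by
    intro w hw
    have hw' := hdom hw
    have h1 : DifferentiableAt ℂ (petalBranch a p v) w :=
      differentiableOn_petalBranch.differentiableAt
        (Complex.isOpen_slitPlane.mem_nhds (hslit hw))
    have h2 : DifferentiableAt ℂ f (petalBranch a p v w) :=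
      hf.differentiableAt (f.open_source.mem_nhds (h.branch_mem w hw'))
    have h3 : f (petalBranch a p v w) ≠ 0 := by
      rw [← h.branch_map w hw']
      exact petalBranch_ne_zero hv.1
    exact ((differentiableAt_petalChart ha hp h3).comp w (h2.comp w h1)).differentiableWithinAt
  have hp0 : (0 : ℝ) < 1 / p := by positivity
  obtain ⟨R', hRR', hmaps, φ, hφ, hinj, hφF⟩ := exists_fatou_coordinate hp0 hC hR hFd
    fun w hw => (h.norm_le w (hdom hw)).trans (mul_le_mul_of_nonneg_left
      (Real.rpow_le_rpow_of_nonpos (hR.trans hw) (Complex.re_le_norm w) (by linarith)) hC)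
  set H : Set ℂ := {w | R' < w.re} with hH
  have hHR : ∀ {w}, w ∈ H → R < w.re := fun hw => lt_of_le_of_lt hRR' hw
  have hinv : ∀ {w}, w ∈ H → petalChart a p (petalBranch a p v w) = w := fun hw =>
    petalChart_petalBranch ha hp hv (Complex.slitPlane_ne_zero (hslit (hHR hw)))
  have hHo : IsOpen H := isOpen_lt continuous_const Complex.continuous_re
  refine isConjugateToTranslationOn_of_iterate_mem hf hP.isOpen hP.subset_source hP.mapsTo
    (S := petalBranch a p v '' H) (ψ := φ ∘ petalChart a p)
    (isOpen_petalBranch_image hp hv.1 hHo fun w hw => hslit (hHR hw)) ?_ ?_ ?_ ?_ fun z hz => ?_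
  · rintro _ ⟨w, hw, rfl⟩
    exact ⟨F w, hmaps w hw, h.branch_map w (hdom (hHR hw))⟩
  · rintro _ ⟨w, hw, rfl⟩
    have h1 : DifferentiableAt ℂ φ (petalChart a p (petalBranch a p v w)) := by
      rw [hinv hw]
      exact hφ.differentiableAt (hHo.mem_nhds hw)
    exact (h1.comp _ (differentiableAt_petalChart ha hp
      (petalBranch_ne_zero hv.1))).differentiableWithinAt
  · rintro _ ⟨w, hw, rfl⟩ _ ⟨w', hw', rfl⟩ heq
    simp only [Function.comp, hinv hw, hinv hw'] at heq
    rw [hinj hw hw' heq]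
  · rintro _ ⟨w, hw, rfl⟩
    simp only [Function.comp, hinv hw]
    exact hφF w hw
  · exact (eventually_mem_petalBranch_image ha hp hv (hP.tendsto_zero z hz)
      (hP.tendsto_direction z hz) R').exists

/-! ### Expansion of the inverse germ. -/

/-- The inverse of `z + a z ^ (p + 1) + ⋯` is `z - a z ^ (p + 1) + ⋯`. -/
theorem HasExpansion.symm {f : OpenPartialHomeomorph ℂ ℂ} {a : ℂ} {p : ℕ}
    (hf : HasExpansion f a p) (hp : p ≠ 0) (h0 : (0 : ℂ) ∈ f.source) (hf0 : f 0 = 0) :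
    HasExpansion f.symm (-a) p := by
  have ht : (0 : ℂ) ∈ f.target := hf0 ▸ f.map_source h0
  have hg0 : f.symm 0 = 0 := by simpa [hf0] using f.left_inv h0
  have hgt : Filter.Tendsto f.symm (𝓝 0) (𝓝 0) := by
    simpa [hg0] using (f.continuousAt_symm ht).tendsto
  have hr := (hf : (fun z : ℂ => f z - (z + a * z ^ (p + 1))) =O[𝓝 0] fun z => z ^ (p + 2))
  have h1 : (fun z : ℂ => f z - z) =O[𝓝 0] fun z => z ^ (p + 1) :=
    ((hr.trans (isBigO_pow_pow_of_le (by omega))).add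
      ((isBigO_refl (fun z : ℂ => z ^ (p + 1)) _).const_mul_left a)).congr_left fun z => by ring
  have hid : ∀ᶠ z in 𝓝 (0 : ℂ), f (f.symm z) = z := f.eventually_right_inverse ht
  have h2 : (fun z : ℂ => z - f.symm z) =O[𝓝 0] fun z => f.symm z ^ (p + 1) :=
    (h1.comp_tendsto hgt).congr' (hid.mono fun z hz => by simp [hz]) Filter.EventuallyEq.rfl
  -- Thus `f.symm z` is asymptotic to `z`, and powers of `f.symm z` can be bounded by powers of `z`.
  have h3 : (fun z : ℂ => z - f.symm z) =o[𝓝 0] fun z => f.symm z := by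
    have h : (fun z : ℂ => z ^ (p + 1)) =o[𝓝 0] fun z : ℂ => z := by
      simpa using isLittleO_pow_pow (𝕜 := ℂ) (m := 1) (n := p + 1) (by omega)
    exact h2.trans_isLittleO (h.comp_tendsto hgt)
  have h4 : (fun z : ℂ => f.symm z) =O[𝓝 0] fun z : ℂ => z :=
    h3.right_isBigO_add.congr_right fun z => sub_add_cancel z (f.symm z)
  have h5 : (fun z : ℂ => z - f.symm z) =O[𝓝 0] fun z => z ^ (p + 1) := h2.trans (h4.pow _)
  have h6 : (fun z : ℂ => ∑ i ∈ Finset.range (p + 1), z ^ i * f.symm z ^ (p + 1 - 1 - i))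
      =O[𝓝 0] fun z => z ^ p := by
    refine IsBigO.fun_sum fun i hi => ?_
    refine ((isBigO_refl (fun z : ℂ => z ^ i) _).mul (h4.pow (p + 1 - 1 - i))).congr_right
      fun z => ?_
    rw [← pow_add]
    congr 1
    have := Finset.mem_range.1 hi
    omega
  -- Factoring the difference of powers gives order `p + (p + 1)`, which is at least `p + 2` because
  -- `p ≥ 1`.
  have h7 : (fun z : ℂ => z ^ (p + 1) - f.symm z ^ (p + 1)) =O[𝓝 0] fun z => z ^ (p + 2) :=
    (((h6.mul h5).congr_left fun z => geom_sum₂_mul z (f.symm z) (p + 1)).congr_right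
      fun z => (pow_add z p (p + 1)).symm).trans (isBigO_pow_pow_of_le (by omega))
  have h8 := (hr.comp_tendsto hgt).trans (h4.pow (p + 2))
  refine ((h7.const_mul_left a).sub h8).congr' (hid.mono fun z hz => ?_) Filter.EventuallyEq.rfl
  simp only [Function.comp, hz]
  ring

/-! ### Cyclic order of the directions. -/

theorem isRepellingDirection_mul_exp_iff {a v : ℂ} {p : ℕ} (hp : p ≠ 0) :
    IsRepellingDirection a p (v * Complex.exp ((Real.pi / p : ℝ) * Complex.I)) ↔
      IsAttractingDirection a p v := by
  have hp' : (p : ℂ) ≠ 0 := by exact_mod_cast hp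
  have h : Complex.exp ((Real.pi / p : ℝ) * Complex.I) ^ p = -1 := by
    rw [← Complex.exp_nat_mul, ← Complex.exp_pi_mul_I]
    congr 1
    push_cast
    field_simp
  rw [isRepellingDirection_iff, IsAttractingDirection, IsAttractingDirection, norm_mul,
    Complex.norm_exp_ofReal_mul_I, mul_one, mul_pow, h, norm_neg, mul_neg_one, neg_mul_neg]

/-- The attracting directions are one solution `v₀` of `a v^p = -‖a‖` times the `p`-th roots of
unity; a rotation by `π / p` changes the sign of `v^p` and gives the repelling ones midway between
them. -/
theorem exists_isOrderedDirections {a : ℂ} (ha : a ≠ 0) (p : ℕ) [NeZero p] :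
    ∃ vp vm : Fin p → ℂ, IsOrderedDirections a p vp vm := by
  have hp : p ≠ 0 := NeZero.ne p
  have hp' : (p : ℂ) ≠ 0 := by exact_mod_cast hp
  have hp0 : (0 : ℝ) < p := by positivity
  have ha' : (‖a‖ : ℂ) ≠ 0 := by simpa using ha
  set v₀ : ℂ := Complex.exp (((Real.pi - a.arg) / p : ℝ) * Complex.I) with hv₀
  set ζ : ℂ := Complex.exp (2 * Real.pi * Complex.I / p) with hζdef
  have hζ : IsPrimitiveRoot ζ p := Complex.isPrimitiveRoot_exp p hp
  have hζn : ‖ζ‖ = 1 := hζ.norm'_eq_one hp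
  have hζ' : ζ = Complex.exp ((2 * Real.pi / p : ℝ) * Complex.I) := by
    rw [hζdef]
    congr 1
    push_cast
    ring
  have hv₀0 : v₀ ≠ 0 := Complex.exp_ne_zero _
  have hv₀a : IsAttractingDirection a p v₀ := by
    refine (isAttractingDirection_iff ha).2 ⟨Complex.norm_exp_ofReal_mul_I _, ?_⟩
    rw [hv₀, ← Complex.exp_nat_mul, show (p : ℂ) * (((Real.pi - a.arg) / p : ℝ) * Complex.I) =
      Real.pi * Complex.I - a.arg * Complex.I by push_cast; field_simp, Complex.exp_sub,
      Complex.exp_pi_mul_I]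
    nth_rewrite 1 [← Complex.norm_mul_exp_arg_mul_I a]
    have := Complex.exp_ne_zero (a.arg * Complex.I)
    field_simp
  have hatt : ∀ {v u : ℂ}, IsAttractingDirection a p v → ‖u‖ = 1 →
      (IsAttractingDirection a p (v * u) ↔ u ^ p = 1) := by
    intro v u hv hu
    rw [isAttractingDirection_iff ha] at hv ⊢
    rw [norm_mul, hv.1, hu, mul_pow, ← mul_assoc, hv.2]
    simp [ha']
  have hvp : ∀ i : ℕ, IsAttractingDirection a p (v₀ * ζ ^ i) := fun i =>
    (hatt hv₀a (by rw [norm_pow, hζn, one_pow])).2 (by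
      rw [← pow_mul, mul_comm, pow_mul, hζ.pow_eq_one, one_pow])
  set e : ℂ := Complex.exp ((Real.pi / p : ℝ) * Complex.I) with he
  have he0 : e ≠ 0 := Complex.exp_ne_zero _
  have hinj : Function.Injective fun i : Fin p => v₀ * ζ ^ (i : ℕ) := fun i j hij =>
    Fin.ext (hζ.pow_inj i.2 j.2 (mul_left_cancel₀ hv₀0 hij))
  have hsurj : ∀ {v}, IsAttractingDirection a p v → ∃ i : Fin p, v₀ * ζ ^ (i : ℕ) = v := by
    intro v hv
    have h1 : (v / v₀) ^ p = 1 := by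
      refine (hatt hv₀a ?_).1 (by rwa [mul_div_cancel₀ _ hv₀0])
      rw [norm_div, hv.1, hv₀a.1, div_one]
    obtain ⟨i, hi, h⟩ := hζ.eq_pow_of_pow_eq_one h1
    exact ⟨⟨i, hi⟩, by rw [h, mul_div_cancel₀ _ hv₀0]⟩
  have hexp1 : ∀ θ : ℝ, Complex.exp (θ * Complex.I) ^ p = 1 → ∃ n : ℤ, p * θ = n * (2 * Real.pi) := by
    intro θ h
    rw [← Complex.exp_nat_mul, Complex.exp_eq_one_iff] at h
    obtain ⟨n, hn⟩ := h
    refine ⟨n, ?_⟩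
    have := congrArg Complex.im hn
    simpa using this
  refine ⟨fun i => v₀ * ζ ^ (i : ℕ), fun i => v₀ * ζ ^ (i : ℕ) * e, hinj,
    fun i j hij => hinj (mul_right_cancel₀ he0 hij), ?_, ?_, fun i => ?_⟩
  · ext v
    refine ⟨?_, fun hv => hsurj hv⟩
    rintro ⟨i, rfl⟩
    exact hvp i
  · ext v
    refine ⟨?_, fun hv => ?_⟩
    · rintro ⟨i, rfl⟩
      exact (isRepellingDirection_mul_exp_iff hp).2 (hvp i)
    · have hv : IsRepellingDirection a p v := hv
      rw [← div_mul_cancel₀ v he0, isRepellingDirection_mul_exp_iff hp] at hv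
      obtain ⟨i, hi⟩ := hsurj hv
      exact ⟨i, by dsimp only; rw [hi, div_mul_cancel₀ _ he0]⟩
  · refine ⟨Real.pi / p, 2 * Real.pi / p, by positivity, ?_, rfl, ?_, fun θ h0 h1 h2 => ⟨?_, ?_⟩⟩
    · gcongr
      linarith [Real.pi_pos]
    -- Exponents are reduced modulo `p` through `ζ^p = 1`. This covers the wrap-around and the case
    -- `p = 1`, where `i + 1 = i` and `t` is a full turn.
    · rw [← hζ', mul_assoc, ← pow_succ, Fin.val_add, ← pow_eq_pow_mod _ hζ.pow_eq_one, pow_add,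
        Fin.val_one', ← pow_eq_pow_mod _ hζ.pow_eq_one, pow_one, pow_succ]
    · rw [hatt (hvp i) (Complex.norm_exp_ofReal_mul_I _)]
      intro h
      obtain ⟨n, hn⟩ := hexp1 θ h
      rw [lt_div_iff₀ hp0] at h1
      have h3 : (0 : ℝ) < n := by
        have : 0 < p * θ := by positivity
        rw [hn] at this
        exact pos_of_mul_pos_left this (by positivity)
      have h4 : (n : ℝ) < 1 := by
        by_contra! h5
        nlinarith [Real.pi_pos]
      norm_cast at h3 h4
      omega
    -- Turning back by `π / p` reduces to attracting directions: `pθ - π` is a multiple of `2π` in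
    -- `(-π, π)`, hence zero, and `θ = π / p` is the excluded `s`.
    · have hrot : v₀ * ζ ^ (i : ℕ) * Complex.exp (θ * Complex.I) =
          v₀ * ζ ^ (i : ℕ) * Complex.exp ((θ - Real.pi / p : ℝ) * Complex.I) * e := by
        rw [he, mul_assoc (v₀ * ζ ^ (i : ℕ)), ← Complex.exp_add]
        congr 2
        push_cast
        ring
      rw [hrot, isRepellingDirection_mul_exp_iff hp, hatt (hvp i) (Complex.norm_exp_ofReal_mul_I _)]
      intro h
      obtain ⟨n, hn⟩ := hexp1 _ h
      rw [mul_sub, mul_div_cancel₀ _ hp0.ne'] at hn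
      rw [lt_div_iff₀ hp0] at h1
      have hpθ : 0 < p * θ := by positivity
      have h3 : (-1 : ℝ) < n := by
        by_contra! h5
        nlinarith [Real.pi_pos]
      have h4 : (n : ℝ) < 1 := by
        by_contra! h5
        nlinarith [Real.pi_pos]
      norm_cast at h3 h4
      obtain rfl : n = 0 := by omega
      refine h2 (by rw [eq_div_iff hp0.ne']; push_cast at hn; linarith)

/-! ### Disjointness and assembly of the petals. -/

/-- A common point has a single coordinate `w`, and the branches at `w` differ only by the factor
`v`. -/
theorem disjoint_petalBranch_image {a v v' : ℂ} {p : ℕ} (ha : a ≠ 0) (hp : p ≠ 0)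
    (hv : IsAttractingDirection a p v) (hv' : IsAttractingDirection a p v') (hne : v ≠ v') {R : ℝ}
    (hR : 0 ≤ R) :
    Disjoint (petalBranch a p v '' petalDomain R) (petalBranch a p v' '' petalDomain R) := by
  rw [Set.disjoint_left]
  rintro _ ⟨w, hw, rfl⟩ ⟨w', hw', heq⟩
  have h := congrArg (petalChart a p) heq
  rw [petalChart_petalBranch ha hp hv (ne_zero_of_mem_petalDomain hR hw),
    petalChart_petalBranch ha hp hv' (ne_zero_of_mem_petalDomain hR hw')] at h
  subst h
  exact hne (mul_right_cancel₀ (Complex.exp_ne_zero _) heq).symm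

theorem theoremt14 (f : OpenPartialHomeomorph ℂ ℂ) (hf : RepresentsDiff f)
    (p : ℕ) [NeZero p] (a : ℂ) (ha : a ≠ 0) (hexp : HasExpansion f a p) :
    (∃ vp vm : Fin p → ℂ, IsOrderedDirections a p vp vm) ∧
    ∀ vp vm : Fin p → ℂ, IsOrderedDirections a p vp vm →
      (∃ Pp Pm : Fin p → Set ℂ,
        (∀ i, IsAttractingPetal f (vp i) (Pp i)) ∧
        (∀ i, IsRepellingPetal f (vm i) (Pm i)) ∧
        {0} ∪ (⋃ i, Pp i) ∪ (⋃ i, Pm i) ∈ 𝓝 (0 : ℂ) ∧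
        (∀ i j, i ≠ j → Disjoint (Pp i) (Pp j)) ∧
        (∀ i j, i ≠ j → Disjoint (Pm i) (Pm j))) ∧
      (∀ i (P : Set ℂ), IsAttractingPetal f (vp i) P → IsConjugateToTranslationOn f P) := by
  have hp : p ≠ 0 := NeZero.ne p
  have ha' : -a ≠ 0 := neg_ne_zero.2 ha
  refine ⟨exists_isOrderedDirections ha p, fun vp vm hord => ?_⟩
  have hvp : ∀ i, IsAttractingDirection a p (vp i) := fun i =>
    hord.range_att.subset (Set.mem_range_self i)
  have hvm : ∀ i, IsAttractingDirection (-a) p (vm i) := fun i =>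
    isRepellingDirection_iff.1 (hord.range_rep.subset (Set.mem_range_self i))
  have hvp' : ∀ {v}, IsAttractingDirection a p v → ∃ i, vp i = v := fun {v} hv =>
    hord.range_att.symm.subset hv
  have hvm' : ∀ {v}, IsAttractingDirection (-a) p v → ∃ i, vm i = v := fun {v} hv =>
    hord.range_rep.symm.subset (isRepellingDirection_iff.2 hv)
  have ht : (0 : ℂ) ∈ f.target := hf.map_zero ▸ f.map_source hf.zero_mem
  obtain ⟨C, R, hC, hR, hT⟩ := hexp.exists_isNearTranslation ha hp
    (f.open_source.mem_nhds hf.zero_mem)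
  obtain ⟨C', R', -, hR', hT'⟩ := (hexp.symm hp hf.zero_mem hf.map_zero).exists_isNearTranslation
    ha' hp (f.open_target.mem_nhds ht)
  refine ⟨⟨fun i => petalBranch a p (vp i) '' petalDomain R,
    fun i => petalBranch (-a) p (vm i) '' petalDomain R',
    fun i => (hT _ (hvp i)).isAttractingPetal ha hp hR (hvp i),
    fun i => (hT' _ (hvm i)).isAttractingPetal (f := f.symm) ha' hp hR' (hvm i), ?_,
    fun i j hij => disjoint_petalBranch_image ha hp (hvp i) (hvp j)
      (hord.injective_att.ne hij) hR.le,
    fun i j hij => disjoint_petalBranch_image ha' hp (hvm i) (hvm j)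
      (hord.injective_rep.ne hij) hR'.le⟩,
    fun i P hP => (hT _ (hvp i)).isConjugateToTranslationOn hf.holomorphic ha hp hC hR (hvp i) hP⟩
  have hlarge := eventually_nhdsWithin_iff.1
    ((tendsto_norm_petalChart ha hp).eventually (Filter.eventually_gt_atTop (max R R')))
  filter_upwards [hlarge] with z hz
  rcases eq_or_ne z 0 with rfl | hz0
  · exact Or.inl (Or.inl rfl)
  have hz := hz hz0
  -- The coordinate for `-a` is the negative of that for `a`, so one of the two has nonnegative real
  -- part, and its large values lie in the model domain.
  rcases le_total 0 (petalChart a p z).re with hre | hre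
  · obtain ⟨v, hv, hzv⟩ := exists_petalBranch_eq ha hp hz0
    obtain ⟨i, rfl⟩ := hvp' hv
    exact Or.inl (Or.inr (Set.mem_iUnion.2 ⟨i, _, mem_petalDomain_of_re_nonneg hre
      ((le_max_left _ _).trans_lt hz), hzv⟩))
  · obtain ⟨v, hv, hzv⟩ := exists_petalBranch_eq ha' hp hz0
    obtain ⟨i, rfl⟩ := hvm' hv
    refine Or.inr (Set.mem_iUnion.2 ⟨i, _, mem_petalDomain_of_re_nonneg ?_ ?_, hzv⟩)
    · rw [petalChart_neg, Complex.neg_re]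
      linarith
    · rw [petalChart_neg, norm_neg]
      exact (le_max_right _ _).trans_lt hz
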